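/- **Polar codes.** Let $F_1=\begin{pmatrix}1&0\\1&1\end{pmatrix}$ and $F_n=\begin{pmatrix}F_{n-1}&0\\F_{n-1}&F_{n-1}\end{pmatrix}$ over $\mathbb F_2$, and let $G_n=B_nF_n$, where $B_n$ is the $2^n\times 2^n$ bit-reversal permutation matrix. For $n\ge 1$, $N=2^n$, a set $\mathcal A\subseteq\{1,\dots,N\}$ of free indices and a frozen vector $v\in\mathbb F_2^{\bar{\mathcal A}}$, the *polar encoding function* $f:\mathbb F_2^{\mathcal A}\to\mathbb F_2^N$ is $$f(u)=u\,G_n(\mathcal A)+v\,G_n(\bar{\mathcal A}),$$ where $G_n(S)$ denotes the rows of $G_n$ with index in $S$. Its block length is $N$ and its rate is $R=|\mathcal A|/N$. **Circuits (Thompson model).** A circuit is laid out on a rectangular chip of $w\times h$ unit squares; its area is $A=wh$. Each square is empty, or contains one node, or a piece of one wire, or a crossing of two wires that both run straight through it. A wire joins two nodes along a path of adjacent squares which between its ends avoids the squares of nodes; each side of a square is crossed at most once, by at most one wire. Each input bit is given to one node (and initially known only there), and distinct output bits are produced by distinct nodes. The circuit is synchronous: in each clock cycle every node, from its memory and the bits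 that have arrived at its wire ends, computes its new memory and one bit to be sent out from each of its wire ends, to be read at the other end in the next clock cycle (so a wire carries one bit per cycle in each direction; initially all wires carry $0$). Nodes may have arbitrary memory and compute arbitrary functions. The circuit computes $f$ in $T$ clock cycles if after $T$ cycles each output node holds, as a function of its memory, its bit of $f(u)$, for every input $u$. If each square of the chip is active in each clock cycle to an extent in $[0,1]$, the switching activity factor $q$ is the average of this extent over all squares and cycles, and the energy is $E=qAT$. **Theorem.** Every circuit in the Thompson model that computes a polar encoding function of block length $N$ and rate $R>\frac12$ satisfies $$AT^2\ \ge\ \frac{N^2(1-2R)^2}{64},$$ and, if its switching activity factor is $q$, its energy satisfies $$E\ \ge\ q\,\frac{N^{3/2}(2R-1)}{8}.$$ Consequently, for every sequence of such circuits with block lengths $N\to\infty$ and rates at least a constant $R_0>\frac12$, one has $AT^2=\Omega(N^2)$, and, if the switching activity factors are at least a constant $q_0>0$, $E=\Omega(N^{3/2})$. -/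

import Mathlib

open Matrix Filter Asymptotics

/-! ### The polar generator matrix and polar encoding functions -/

/-- The identification of two consecutive blocks of `2 ^ n` indices with `2 ^ (n + 1)` indices. -/
def blockEquiv (n : ℕ) : Fin (2 ^ n) ⊕ Fin (2 ^ n) ≃ Fin (2 ^ (n + 1)) :=
  finSumFinEquiv.trans (finCongr (by rw [pow_succ, mul_two]))

/-- The matrices `F n`, with `F (n + 1) = [F n, 0; F n, F n]`. Starting the recursion with the
`1 × 1` matrix `F 0 = [1]` gives `F 1 = [1, 0; 1, 1]`. -/
def polarF : (n : ℕ) → Matrix (Fin (2 ^ n)) (Fin (2 ^ n)) (ZMod 2)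
  | 0 => 1
  | n + 1 => Matrix.reindex (blockEquiv n) (blockEquiv n)
      (Matrix.fromBlocks (polarF n) 0 (polarF n) (polarF n))

/-- Reversal of the `n` binary digits of an index. -/
def bitReversal (n : ℕ) : Equiv.Perm (Fin (2 ^ n)) :=
  finFunctionFinEquiv.symm.trans
    ((Equiv.arrowCongr Fin.revPerm (Equiv.refl (Fin 2))).trans finFunctionFinEquiv)

/-- The universal polar coding generator matrix `G n = B n * F n`, where `B n` is the bit-reversal
permutation matrix. -/
def polarG (n : ℕ) : Matrix (Fin (2 ^ n)) (Fin (2 ^ n)) (ZMod 2) :=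
  (bitReversal n).permMatrix (ZMod 2) * polarF n

/-- The polar encoding function with set of free indices `free` and frozen vector `frozen`: the
vector `u` of free bits is mapped to `u * G(free) + frozen * G(complement of free)`, where `G(S)`
is the submatrix of the generator matrix formed by the rows with indices in `S`. -/
def polarEncode (n : ℕ) (free : Finset (Fin (2 ^ n)))
    (frozen : {i : Fin (2 ^ n) // i ∉ free} → ZMod 2)
    (u : {i : Fin (2 ^ n) // i ∈ free} → ZMod 2) : Fin (2 ^ n) → ZMod 2 :=
  u ᵥ* (polarG n).submatrix Subtype.val id + frozen ᵥ* (polarG n).submatrix Subtype.val id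

/-! ### Circuits in the Thompson model -/

/-- A unit square of the planar grid, given by its column and its row. -/
abbrev Square : Type := ℤ × ℤ

/-- Two unit squares are adjacent if they have a side in common. -/
def Square.Adjacent (s t : Square) : Prop :=
  (s.1 = t.1 ∧ |s.2 - t.2| = 1) ∨ (|s.1 - t.1| = 1 ∧ s.2 = t.2)

/-- A synchronous circuit in the Thompson model, with input bits indexed by `ι` and output bits
indexed by `κ`. It is laid out on a rectangular chip divided into unit squares. A square is empty,
or it contains one node, or a piece of one wire, or a crossing of two wires. Wires have unit width
and join nodes; every wire carries one bit in each of its two directions per clock cycle. A node may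
have a memory and compute any function. Each input bit is given to one node, and each output bit is
produced by a node of its own. -/
structure ThompsonCircuit (ι κ : Type) where
  /-- The width of the chip, in unit squares. -/
  width : ℕ
  /-- The height of the chip, in unit squares. -/
  height : ℕ
  Node : Type
  [nodeFintype : Fintype Node]
  Wire : Type
  [wireFintype : Fintype Wire]
  /-- The square of each node. -/
  pos : Node → Square
  pos_injective : Function.Injective pos
  pos_mem : ∀ v, pos v ∈ Finset.Ico (0 : ℤ) width ×ˢ Finset.Ico (0 : ℤ) height
  /-- The two end nodes of each wire; the ends are named `false` and `true`. -/
  endNode : Wire × Bool → Node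
  /-- The number of square sides that the wire crosses on its way. -/
  len : Wire → ℕ
  len_pos : ∀ w, 0 < len w
  /-- The squares `route w 0, …, route w (len w)` through which the wire runs. -/
  route : Wire → ℕ → Square
  route_mem : ∀ w, ∀ k ≤ len w,
    route w k ∈ Finset.Ico (0 : ℤ) width ×ˢ Finset.Ico (0 : ℤ) height
  route_zero : ∀ w, route w 0 = pos (endNode (w, false))
  route_len : ∀ w, route w (len w) = pos (endNode (w, true))
  route_adjacent : ∀ w, ∀ k < len w, (route w k).Adjacent (route w (k + 1))
  /-- Between its ends, a wire does not run through squares of nodes. -/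
  route_avoids_nodes : ∀ w k, 0 < k → k < len w → ∀ v, route w k ≠ pos v
  /-- A side of a square is crossed at most once, by at most one wire. -/
  side_unique : ∀ w k w' k', k < len w → k' < len w' →
    s(route w k, route w (k + 1)) = s(route w' k', route w' (k' + 1)) → w = w' ∧ k = k'
  /-- Where two pieces of wire share a square, both run straight through it. -/
  crossing_straight : ∀ w k w' k', 0 < k → k < len w → 0 < k' → k' < len w' →
    route w k = route w' k' → (w ≠ w' ∨ k ≠ k') →
    route w (k - 1) + route w (k + 1) = 2 • route w k
  /-- The node to which each input bit is given. -/
  inputNode : ι → Node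
  /-- The node that produces each output bit. -/
  outputNode : κ → Node
  outputNode_injective : Function.Injective outputNode
  /-- The possible contents of the memory of a node. -/
  State : Node → Type
  /-- The memory of a node at the start, which depends only on the input bits given to the node. -/
  init : (v : Node) → ({i : ι // inputNode i = v} → ZMod 2) → State v
  /-- What a node does in one clock cycle: from its memory and the bits that have arrived at the
  wire ends attached to it, it computes its new memory and one bit to be sent from each of these
  wire ends. -/
  step : (v : Node) → State v → ({e : Wire × Bool // endNode e = v} → ZMod 2) →
    State v × ({e : Wire × Bool // endNode e = v} → ZMod 2)
  /-- The output bit of an output node, as a function of its memory. -/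
  output : (j : κ) → State (outputNode j) → ZMod 2
  /-- The number of clock cycles of the computation. -/
  cycles : ℕ

namespace ThompsonCircuit

variable {ι κ : Type}

/-- The unit squares of the chip. -/
noncomputable def chip (c : ThompsonCircuit ι κ) : Finset Square :=
  Finset.Ico (0 : ℤ) c.width ×ˢ Finset.Ico (0 : ℤ) c.height

/-- The circuit area: the number of unit squares of the chip. -/
def area (c : ThompsonCircuit ι κ) : ℕ := c.width * c.height

/-- The contents of all memories, and the bits that have arrived at the wire ends and are read in
the next clock cycle. -/
structure Config (c : ThompsonCircuit ι κ) where
  mem : (v : c.Node) → c.State v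
  arrived : c.Wire × Bool → ZMod 2

/-- The configuration after `t` clock cycles on the input `u`. A bit sent from one end of a wire in
a clock cycle is read at its other end in the following clock cycle; at the start, all wires carry
`0`. -/
def run (c : ThompsonCircuit ι κ) (u : ι → ZMod 2) : ℕ → c.Config
  | 0 => { mem := fun v => c.init v fun i => u i, arrived := fun _ => 0 }
  | t + 1 =>
    { mem := fun v => (c.step v ((c.run u t).mem v) fun e => (c.run u t).arrived e).1
      arrived := fun e =>
        (c.step (c.endNode (e.1, !e.2)) ((c.run u t).mem (c.endNode (e.1, !e.2)))
          fun e' => (c.run u t).arrived e').2 ⟨(e.1, !e.2), rfl⟩ }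

/-- The circuit computes `f`: after all its clock cycles, the output nodes hold the bits of `f u`,
for every input `u`. -/
def Computes (c : ThompsonCircuit ι κ) (f : (ι → ZMod 2) → κ → ZMod 2) : Prop :=
  ∀ u j, c.output j ((c.run u c.cycles).mem (c.outputNode j)) = f u j

/-- A record of the activity of a circuit: for every clock cycle and every unit square of the chip,
the extent (between `0` and `1`, for instance the probability) to which the square is active in that
clock cycle. -/
structure Activity (c : ThompsonCircuit ι κ) where
  level : Fin c.cycles → Square → ℝ
  level_nonneg : ∀ t s, 0 ≤ level t s
  level_le_one : ∀ t s, level t s ≤ 1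

/-- The switching activity factor: the fraction of the circuit that is active on average per clock
cycle. -/
noncomputable def switchingFactor {c : ThompsonCircuit ι κ} (a : c.Activity) : ℝ :=
  (∑ t, (∑ s ∈ c.chip, a.level t s) / c.area) / c.cycles

/-- The energy `q * A * T` of a circuit with switching activity factor `q`, area `A` and `T` clock
cycles. -/
noncomputable def energy {c : ThompsonCircuit ι κ} (a : c.Activity) : ℝ :=
  switchingFactor a * c.area * c.cycles

end ThompsonCircuit

/-- A polar encoder: a circuit in the Thompson model that computes a polar encoding function of
block length `2 ^ n`, together with a record of its activity. -/
structure PolarEncoder where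
  n : ℕ
  one_le_n : 1 ≤ n
  free : Finset (Fin (2 ^ n))
  frozen : {i : Fin (2 ^ n) // i ∉ free} → ZMod 2
  circuit : ThompsonCircuit {i : Fin (2 ^ n) // i ∈ free} (Fin (2 ^ n))
  computes : circuit.Computes (polarEncode n free frozen)
  activity : circuit.Activity

namespace PolarEncoder

/-- The block length `N`. -/
def N (e : PolarEncoder) : ℕ := 2 ^ e.n

/-- The rate `R`: the number of free indices divided by the block length. -/
noncomputable def R (e : PolarEncoder) : ℝ := e.free.card / e.N

/-- The circuit area `A`. -/
def A (e : PolarEncoder) : ℕ := e.circuit.area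

/-- The number of clock cycles `T`. -/
def T (e : PolarEncoder) : ℕ := e.circuit.cycles

/-- The switching activity factor `q`. -/
noncomputable def q (e : PolarEncoder) : ℝ := ThompsonCircuit.switchingFactor e.activity

/-- The energy `E`. -/
noncomputable def energy (e : PolarEncoder) : ℝ := ThompsonCircuit.energy e.activity

end PolarEncoder

/-! Up to a permutation of rows, `polarG n` is the zeta matrix of the Boolean lattice: its entry is
1 iff the column's digits lie below the row's.

The algebraic core is `card_mul_card_le_of_rank`: two row sets cannot both have low rank on
complementary column sets. For a shift `c`, pair each row `a` with the row `xor c a`. For suitable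
column weights in `(ZMod 2)[X]`, the Gram matrix of these pairs factors over coordinates and has
nonzero determinant. Splitting its sum over columns into `Y`, `Y'` and the rest bounds its size by
the two ranks plus the number of remaining columns; summing over the `2 ^ n` shifts gives the
product bound.

On the chip, take the column of squares containing the median input. Half of the inputs, `I`, lie in
or before it, the others in or after it. Outputs strictly after it depend on `I` with rank at most
`h * (T - 1)`, the number of bits that can cross the cut in time (`rank_le_of_incoming`,
`natCard_incoming_le`); outputs strictly before it depend on `Iᶜ` likewise; at most `h` outputs lie
inside it. With `K` free bits this gives `K ^ 2 ≤ 8 * N * h * T` (`sq_card_le`), and the same with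
the width. Multiplying the two bounds gives the area-time bound; `N ≤ A` then gives the energy
bound. -/

/-! ### The polar matrix as a zeta matrix -/

/-- The binary digits of an index, most significant digit first. -/
def digits : (n : ℕ) → Fin (2 ^ n) ≃ (Fin n → Bool)
  | 0 => (finCongr (pow_zero 2)).trans (Equiv.ofUnique _ _)
  | n + 1 => (blockEquiv n).symm.trans <|
      (Equiv.boolProdEquivSum _).symm.trans <|
      ((Equiv.refl Bool).prodCongr (digits n)).trans (Fin.consEquiv fun _ => Bool)

/-- The zeta function of the Boolean lattice `Fin n → Bool`, as a product over coordinates. -/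
def zeta (R : Type*) [CommSemiring R] {n : ℕ} (a x : Fin n → Bool) : R :=
  ∏ i, if x i ≤ a i then 1 else 0

theorem zeta_self (R : Type*) [CommSemiring R] {n : ℕ} (a : Fin n → Bool) : zeta R a a = 1 := by
  simp [zeta]

theorem zeta_bot (R : Type*) [CommSemiring R] {n : ℕ} (a : Fin n → Bool) :
    zeta R a (fun _ => false) = 1 := by
  simp [zeta]

theorem map_zeta {R R' : Type*} [CommSemiring R] [CommSemiring R'] (φ : R →+* R') {n : ℕ}
    (a x : Fin n → Bool) : φ (zeta R a x) = zeta R' a x := by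
  simp only [zeta, map_prod]
  exact Finset.prod_congr rfl fun i _ => by split_ifs <;> simp

/-- The only zero block of the recursion has leading row digit 0 and leading column digit 1, which
is the one failure of `x i ≤ a i`. -/
theorem polarF_apply : ∀ (n : ℕ) (k l : Fin (2 ^ n)),
    polarF n k l = zeta (ZMod 2) (digits n k) (digits n l)
  | 0, k, l => by
    have : k = l := Subsingleton.elim (α := Fin 1) k l
    subst this
    simp only [zeta_self]
    exact Matrix.one_apply_eq k
  | n + 1, k, l => by
    obtain ⟨k, rfl⟩ := (blockEquiv n).surjective k
    obtain ⟨l, rfl⟩ := (blockEquiv n).surjective l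
    rcases k with k | k <;> rcases l with l | l <;>
      simp [polarF, zeta, digits, Fin.prod_univ_succ, polarF_apply n]

/-- The binary digits that index the rows of the generator matrix. -/
def rowDigits (n : ℕ) : Fin (2 ^ n) ≃ (Fin n → Bool) :=
  (bitReversal n).trans (digits n)

theorem polarG_apply (n : ℕ) (k l : Fin (2 ^ n)) :
    polarG n k l = zeta (ZMod 2) (rowDigits n k) (digits n l) := by
  simp [polarG, Equiv.Perm.permMatrix, PEquiv.toMatrix_toPEquiv_mul, polarF_apply, rowDigits]

/-! ### Ranks and determinants -/

theorem Matrix.exists_mul_eq_of_rank {K : Type*} [Field K] {m n : Type*} [Fintype m] [Fintype n]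
    (A : Matrix m n K) :
    ∃ (B : Matrix m (Fin A.rank) K) (C : Matrix (Fin A.rank) n K), B * C = A := by
  classical
  let b : Module.Basis (Fin A.rank) K (LinearMap.range A.mulVecLin) :=
    Module.finBasisOfFinrankEq _ _ rfl
  refine ⟨of fun i k => (b k : m → K) i,
    of fun k j => b.repr ⟨A.mulVecLin (Pi.single j 1), LinearMap.mem_range_self _ _⟩ k, ?_⟩
  ext i j
  have h := congrArg (fun v : LinearMap.range A.mulVecLin => (v : m → K) i)
    (b.sum_repr ⟨A.mulVecLin (Pi.single j 1), LinearMap.mem_range_self _ _⟩)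
  simp only [Submodule.coe_sum, Finset.sum_apply, Submodule.coe_smul, Pi.smul_apply, smul_eq_mul,
    mulVecLin_apply, mulVec_single_one, col_apply] at h
  rw [mul_apply, ← h]
  simp only [of_apply, mulVecLin_apply, mulVec_single_one]
  exact Finset.sum_congr rfl fun k _ => mul_comm _ _

theorem Matrix.det_eq_one_of_unitriangular {α R : Type*} [PartialOrder α] [Fintype α]
    [DecidableEq α] [CommRing R] (M : Matrix α α R) (hdiag : ∀ a, M a a = 1)
    (hM : ∀ a b, ¬ a ≤ b → M a b = 0) : M.det = 1 := by
  -- Along a linear extension of the order, `M` is upper triangular in the usual sense.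
  have h : ∀ a b : LinearExtension α, b < a → M a b = 0 := fun a b hab =>
    hM a b fun hle => absurd (toLinearExtension.monotone hle) (not_le.mpr hab)
  have hdet : ∀ d : DecidableEq α, @det α d _ R _ M = 1 := fun d => by
    rw [Subsingleton.elim d fun a b : LinearExtension α => LinearOrder.toDecidableEq a b]
    let _ : Fintype (LinearExtension α) := ‹Fintype α›
    have hN : det (n := LinearExtension α) M = ∏ a, M a a :=
      det_of_isUpperTriangular (m := LinearExtension α) (M := M) h
    exact hN.trans (Finset.prod_eq_one fun a _ => hdiag a)
  exact hdet _

/-! ### A weighted Gram matrix of the zeta matrix -/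

section Gram

open Polynomial

/-- The weight of a column in the Gram matrix that pairs each row `a` with the row `xor c a`. -/
noncomputable def gramWeight {n : ℕ} (c x : Fin n → Bool) : (ZMod 2)[X] :=
  ∏ i, if c i then (if x i then X - 1 else 1) else (if x i then 1 - X else X)

/-- The sum factors over coordinates, leaving a check of the eight values of `c i`, `a i`, `b i`.
The first product depends on the row only; the second is a deformation of the order relation. -/
theorem sum_gramWeight_mul_zeta {n : ℕ} (c a b : Fin n → Bool) :
    ∑ x, gramWeight c x * (zeta (ZMod 2)[X] a x * zeta (ZMod 2)[X] (fun i => xor (c i) (b i)) x) =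
      (∏ i, if c i || a i then 1 else X) * ∏ i, if a i ≤ b i then 1 else X := by
  simp only [gramWeight, zeta, ← Finset.prod_mul_distrib]
  have h := Finset.prod_univ_sum (R := (ZMod 2)[X]) (fun _ : Fin n => (Finset.univ : Finset Bool))
    fun i y => (if c i then (if y then X - 1 else 1) else (if y then 1 - X else X)) *
      ((if y ≤ a i then 1 else 0) * (if y ≤ xor (c i) (b i) then 1 else 0))
  rw [Fintype.piFinset_univ] at h
  rw [← h]
  refine Finset.prod_congr rfl fun i _ => ?_
  have htf : ¬ (true ≤ false) := by decide
  rcases c i <;> rcases a i <;> rcases b i <;> simp [htf]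

/-- The indeterminate serves two purposes: the row factors are powers of `X`, hence nonzero, while
the remaining matrix becomes unitriangular at `X = 0`. -/
theorem det_gram_ne_zero {n : ℕ} (c : Fin n → Bool) (J : Finset (Fin n → Bool)) :
    (of fun a b : J => ∑ x, gramWeight c x * (zeta (ZMod 2)[X] a.1 x *
      zeta (ZMod 2)[X] (fun i => xor (c i) (b.1 i)) x)).det ≠ 0 := by
  simp only [sum_gramWeight_mul_zeta]
  let M : Matrix J J (ZMod 2)[X] := of fun a b => ∏ i, if a.1 i ≤ b.1 i then 1 else X
  have hM : M.det ≠ 0 := by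
    intro h0
    have h1 : ((evalRingHom (0 : ZMod 2)).mapMatrix M).det = 1 := by
      refine det_eq_one_of_unitriangular _ (fun a => by simp [M]) fun a b hab => ?_
      obtain ⟨i, hi⟩ : ∃ i, ¬ a.1 i ≤ b.1 i := by
        by_contra! hle
        exact hab fun i => hle i
      simp only [M, RingHom.mapMatrix_apply, map_apply, of_apply, map_prod]
      exact Finset.prod_eq_zero (Finset.mem_univ i) (by simp [hi])
    rw [← RingHom.map_det, h0, map_zero] at h1
    exact zero_ne_one h1
  have h := det_mul_column (fun a : J => ∏ i, if c i || a.1 i then 1 else (X : (ZMod 2)[X])) M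
  refine (h.trans_ne (mul_ne_zero (Finset.prod_ne_zero_iff.2 fun a _ =>
    Finset.prod_ne_zero_iff.2 fun i _ => ?_) hM) : _)
  split_ifs
  exacts [one_ne_zero, X_ne_zero]

end Gram

/-- The nonsingular Gram matrix on `J` factors through a space whose dimension is the right-hand
side. -/
theorem card_le_of_xor_mem {n : ℕ} (c : Fin n → Bool) (J : Finset (Fin n → Bool))
    (I I' Y Y' : Finset (Fin (2 ^ n))) (hY : Disjoint Y Y')
    (hI : ∀ a ∈ J, (rowDigits n).symm a ∈ I)
    (hI' : ∀ a ∈ J, (rowDigits n).symm (fun i => xor (c i) (a i)) ∈ I') :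
    J.card ≤ ((polarG n).submatrix (Subtype.val : I → _) (Subtype.val : Y → _)).rank +
        ((polarG n).submatrix (Subtype.val : I' → _) (Subtype.val : Y' → _)).rank +
        (Y ∪ Y')ᶜ.card := by
  obtain ⟨B, C, hBC⟩ := Matrix.exists_mul_eq_of_rank
    ((polarG n).submatrix (Subtype.val : I → _) (Subtype.val : Y → _))
  obtain ⟨B', C', hBC'⟩ := Matrix.exists_mul_eq_of_rank
    ((polarG n).submatrix (Subtype.val : I' → _) (Subtype.val : Y' → _))
  generalize ((polarG n).submatrix (Subtype.val : I → _) (Subtype.val : Y → _)).rank = r at *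
  generalize ((polarG n).submatrix (Subtype.val : I' → _) (Subtype.val : Y' → _)).rank = r' at *
  let φ : ZMod 2 →+* Polynomial (ZMod 2) := Polynomial.C
  let w : Fin (2 ^ n) → Polynomial (ZMod 2) := fun l => gramWeight c (digits n l)
  let g : J → Fin (2 ^ n) → Polynomial (ZMod 2) := fun a l =>
    zeta _ a.1 (digits n l)
  let g' : J → Fin (2 ^ n) → Polynomial (ZMod 2) := fun a l =>
    zeta _ (fun i => xor (c i) (a.1 i)) (digits n l)
  have hg : ∀ a (l : Y), g a l = ∑ k, φ (B ⟨_, hI a.1 a.2⟩ k) * φ (C k l) := fun a l => by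
    have h := congrFun (congrFun hBC ⟨_, hI a.1 a.2⟩) l
    rw [submatrix_apply, polarG_apply, Equiv.apply_symm_apply, mul_apply] at h
    simp only [g, ← map_zeta φ, ← h, map_sum, map_mul]
  have hg' : ∀ a (l : Y'), g' a l = ∑ k, φ (B' ⟨_, hI' a.1 a.2⟩ k) * φ (C' k l) := fun a l => by
    have h := congrFun (congrFun hBC' ⟨_, hI' a.1 a.2⟩) l
    rw [submatrix_apply, polarG_apply, Equiv.apply_symm_apply, mul_apply] at h
    simp only [g', ← map_zeta φ, ← h, map_sum, map_mul]
  -- Columns in `Y` go through the rank factorization of the rows `a`, those in `Y'` through that of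
  -- the partner rows; each remaining column costs one dimension.
  let L : Matrix J (Fin r ⊕ Fin r' ⊕ ((Y ∪ Y')ᶜ : Finset _)) (Polynomial (ZMod 2)) :=
    of fun a => Sum.elim (fun k => φ (B ⟨_, hI a.1 a.2⟩ k))
      (Sum.elim (fun k => ∑ l : Y', w l * g a l * φ (C' k l))
        fun l : ((Y ∪ Y')ᶜ : Finset _) => w l * g a l)
  let R : Matrix (Fin r ⊕ Fin r' ⊕ ((Y ∪ Y')ᶜ : Finset _)) J (Polynomial (ZMod 2)) :=
    of fun s b => Sum.elim (fun k => ∑ l : Y, φ (C k l) * (w l * g' b l))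
      (Sum.elim (fun k => φ (B' ⟨_, hI' b.1 b.2⟩ k)) 
        fun l : ((Y ∪ Y')ᶜ : Finset _) => g' b l) s
  have hLR : (of fun a b : J => ∑ x, gramWeight c x * (zeta (Polynomial (ZMod 2)) a.1 x *
      zeta (Polynomial (ZMod 2)) (fun i => xor (c i) (b.1 i)) x)) = L * R := by
    ext1 a b
    have h1 : ∑ l ∈ Y, w l * (g a l * g' b l) =
        ∑ k, φ (B ⟨_, hI a.1 a.2⟩ k) * ∑ l : Y, φ (C k l) * (w l * g' b l) := by
      rw [← Finset.sum_coe_sort]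
      simp only [hg, Finset.sum_mul, Finset.mul_sum]
      rw [Finset.sum_comm]
      exact Finset.sum_congr rfl fun k _ => Finset.sum_congr rfl fun l _ => by ring
    have h2 : ∑ l ∈ Y', w l * (g a l * g' b l) =
        ∑ k, (∑ l : Y', w l * g a l * φ (C' k l)) * φ (B' ⟨_, hI' b.1 b.2⟩ k) := by
      rw [← Finset.sum_coe_sort]
      simp only [hg', Finset.sum_mul, Finset.mul_sum]
      rw [Finset.sum_comm]
      exact Finset.sum_congr rfl fun k _ => Finset.sum_congr rfl fun l _ => by ring
    have h3 : ∑ l ∈ (Y ∪ Y')ᶜ, w l * (g a l * g' b l) =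
        ∑ l : ((Y ∪ Y')ᶜ : Finset _), w l * g a l * g' b l := by
      rw [← Finset.sum_coe_sort]
      exact Finset.sum_congr rfl fun l _ => by ring
    have hD : (of fun a b : J => ∑ x, gramWeight c x * (zeta (Polynomial (ZMod 2)) a.1 x *
        zeta (Polynomial (ZMod 2)) (fun i => xor (c i) (b.1 i)) x)) a b =
          ∑ l, w l * (g a l * g' b l) :=
      ((digits n).sum_comp _).symm
    rw [hD, mul_apply, Fintype.sum_sum_type, Fintype.sum_sum_type,
      ← Finset.sum_add_sum_compl (Y ∪ Y'), Finset.sum_union hY, h1, h2, h3, add_assoc]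
    simp only [L, R, of_apply, Sum.elim_inl, Sum.elim_inr]
  have hdet := det_gram_ne_zero c J
  rw [hLR] at hdet
  have hrank := rank_of_det_ne_zero hdet
  rw [Fintype.card_coe] at hrank
  refine hrank.ge.trans ((rank_mul_le_left _ _).trans ((rank_le_card_width _).trans_eq ?_))
  simp only [Fintype.card_sum, Fintype.card_fin, Fintype.card_coe, add_assoc]

/-- Two sets of rows of the generator matrix cannot be nearly supported on complementary sets of
columns. -/
theorem card_mul_card_le_of_rank {n : ℕ} (I I' Y Y' : Finset (Fin (2 ^ n))) (hY : Disjoint Y Y') :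
    I.card * I'.card ≤ 2 ^ n *
      (((polarG n).submatrix (Subtype.val : I → _) (Subtype.val : Y → _)).rank +
        ((polarG n).submatrix (Subtype.val : I' → _) (Subtype.val : Y' → _)).rank +
        (Y ∪ Y')ᶜ.card) := by
  classical
  let J : (Fin n → Bool) → Finset (Fin n → Bool) := fun c => Finset.univ.filter fun a =>
    (rowDigits n).symm a ∈ I ∧ (rowDigits n).symm (fun i => xor (c i) (a i)) ∈ I'
  have hJ : ∀ c, (J c).card ≤ _ := fun c => card_le_of_xor_mem c (J c) I I' Y Y' hY
    (fun a ha => (Finset.mem_filter.1 ha).2.1) fun a ha => (Finset.mem_filter.1 ha).2.2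
  calc I.card * I'.card = (I ×ˢ I').card := (Finset.card_product _ _).symm
    _ ≤ (Finset.univ.sigma J).card := by
      -- Each pair in `I ×ˢ I'` is counted under the shift that is the xor of its two rows.
      refine Finset.card_le_card_of_injOn (fun p =>
        ⟨fun i => xor (rowDigits n p.2 i) (rowDigits n p.1 i), rowDigits n p.1⟩) ?_ ?_
      · rintro ⟨k, l⟩ hkl
        simp only [Finset.coe_product, Set.mem_prod, Finset.mem_coe] at hkl
        simp [J, hkl.1, hkl.2]
      · rintro ⟨k, l⟩ - ⟨k', l'⟩ - h
        simp only [Sigma.mk.injEq, heq_eq_eq, EmbeddingLike.apply_eq_iff_eq] at h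
        obtain ⟨h, rfl⟩ := h
        have : rowDigits n l = rowDigits n l' := funext fun i => by simpa using congrFun h i
        rw [(rowDigits n).injective this]
    _ = ∑ c, (J c).card := Finset.card_sigma _ _
    _ ≤ ∑ _c : Fin n → Bool, _ := Finset.sum_le_sum fun c _ => hJ c
    _ = _ := by simp

/-! ### Communication across a cut of a circuit -/

namespace ThompsonCircuit

variable {ι κ : Type}

/-- A wire end at a node of `Y` whose wire comes from outside of `Y`. -/
def Incoming (c : ThompsonCircuit ι κ) (Y : Set c.Node) (e : c.Wire × Bool) : Prop :=
  c.endNode e ∈ Y ∧ c.endNode (e.1, !e.2) ∉ Y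

/-- The part of the circuit in `Y` is deterministic given its own inputs and the bits entering from
outside. -/
theorem run_eq_of_incoming_eq (c : ThompsonCircuit ι κ) (Y : Set c.Node) (u u' : ι → ZMod 2)
    (hu : ∀ i, c.inputNode i ∈ Y → u i = u' i) (T : ℕ)
    (h : ∀ t < T, ∀ e, c.Incoming Y e → (c.run u t).arrived e = (c.run u' t).arrived e) :
    ∀ t ≤ T, (∀ v ∈ Y, (c.run u t).mem v = (c.run u' t).mem v) ∧
      (t < T → ∀ e, c.endNode e ∈ Y → (c.run u t).arrived e = (c.run u' t).arrived e)
  | 0, _ => by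
    refine ⟨fun v hv => congrArg (c.init v) (funext fun i => hu i ?_), fun _ _ _ => rfl⟩
    rw [i.2]
    exact hv
  | t + 1, ht => by
    obtain ⟨hmem, harr⟩ := run_eq_of_incoming_eq c Y u u' hu T h t (by omega)
    have hstep : ∀ v ∈ Y, c.step v ((c.run u t).mem v) (fun e => (c.run u t).arrived e) =
        c.step v ((c.run u' t).mem v) fun e => (c.run u' t).arrived e := fun v hv => by
      rw [hmem v hv]
      exact congrArg _ (funext fun e => harr ht e (by rw [e.2]; exact hv))
    refine ⟨fun v hv => congrArg Prod.fst (hstep v hv), fun htT e he => ?_⟩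
    by_cases he' : c.endNode (e.1, !e.2) ∈ Y
    · exact congrFun (congrArg Prod.snd (hstep _ he')) _
    · exact h _ htT e ⟨he, he'⟩

/-- The linear dependence of the outputs of `Y` on the inputs outside of `Y` has rank at most the
number of bits that can be sent to `Y` so that they are read before the computation ends. -/
theorem rank_le_of_incoming [Fintype ι] [Fintype κ] (c : ThompsonCircuit ι κ)
    {f : (ι → ZMod 2) → κ → ZMod 2} (hc : c.Computes f) (G : Matrix ι κ (ZMod 2))
    (hf : ∀ u, f u = u ᵥ* G + f 0) (Y : Set c.Node) (I : Finset ι) (O : Finset κ)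
    (hI : ∀ i ∈ I, c.inputNode i ∉ Y) (hO : ∀ j ∈ O, c.outputNode j ∈ Y) {b : ℕ}
    (hb : Nat.card {e // c.Incoming Y e} ≤ b) :
    (G.submatrix (Subtype.val : I → ι) (Subtype.val : O → κ)).rank ≤ b * (c.cycles - 1) := by
  classical
  have := c.wireFintype
  set A := G.submatrix (Subtype.val : I → ι) (Subtype.val : O → κ) with hA
  let ext (x : I → ZMod 2) : ι → ZMod 2 := fun i => if h : i ∈ I then x ⟨i, h⟩ else 0
  have hext : ∀ x (j : O), (ext x ᵥ* G) j = (x ᵥ* A) j := fun x j => by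
    simp only [vecMul, dotProduct]
    rw [← Finset.sum_subset I.subset_univ fun i _ hi => by simp [ext, hi], ← Finset.sum_coe_sort]
    exact Finset.sum_congr rfl fun i _ => by simp [ext, hA]
  let W := LinearMap.range Aᵀ.mulVecLin
  have hW : ∀ y : W, ∃ x, x ᵥ* A = y := fun y => by
    obtain ⟨x, hx⟩ := y.2
    exact ⟨x, by rw [← hx, mulVecLin_apply, mulVec_transpose]⟩
  choose x hx using hW
  -- Only arrivals at times `1, …, cycles - 1` matter: at time 0 every wire carries 0, and bits sent
  -- in the last cycle are never read.
  let msg (y : W) : {e // c.Incoming Y e} × Fin (c.cycles - 1) → ZMod 2 := fun p =>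
    (c.run (ext (x y)) (p.2 + 1)).arrived p.1
  have hmsg : Function.Injective msg := fun y y' h => by
    have hrun := run_eq_of_incoming_eq c Y (ext (x y)) (ext (x y')) (fun i hi => by
      have : i ∉ I := fun hi' => hI i hi' hi
      simp [ext, this]) c.cycles (fun t ht e he => by
      rcases t with _ | t
      · rfl
      · exact congrFun h (⟨e, he⟩, ⟨t, by omega⟩)) c.cycles le_rfl
    refine Subtype.ext (funext fun j => ?_)
    have h1 := hc (ext (x y)) j
    rw [hrun.1 _ (hO j j.2), hc, hf (ext (x y)), hf (ext (x y')), Pi.add_apply, Pi.add_apply,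
      hext, hext, hx, hx] at h1
    exact (add_right_cancel h1).symm
  have hcard := Fintype.card_le_of_injective msg hmsg
  rw [Module.card_eq_pow_finrank (K := ZMod 2), Fintype.card_fun, ZMod.card, Fintype.card_prod,
    Fintype.card_fin, ← Nat.card_eq_fintype_card] at hcard
  have hrank := (Nat.pow_le_pow_iff_right one_lt_two).1 hcard
  rw [← rank_transpose]
  exact hrank.trans (Nat.mul_le_mul_right _ hb)

/-- A wire with ends on both sides of the cut crosses one of its at most `h` square sides, and no
side serves two wires. Abstract coordinates `p`, `q` cover vertical and horizontal cuts together. -/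
theorem natCard_incoming_le (c : ThompsonCircuit ι κ) {p q : Square → ℤ} {h : ℕ}
    (hadj : ∀ s t, Square.Adjacent s t → p s = p t ∨ (|p s - p t| = 1 ∧ q s = q t))
    (hpq : ∀ s t, p s = p t → q s = q t → s = t) (hq : ∀ s ∈ c.chip, q s ∈ Finset.Ico (0 : ℤ) h)
    (x : ℤ) (Y : Set c.Node) (hY : Y = {v | p (c.pos v) < x} ∨ Y = {v | p (c.pos v) < x}ᶜ) :
    Nat.card {e // c.Incoming Y e} ≤ h := by
  have hcross : ∀ e : {e // c.Incoming Y e}, ∃ k < c.len e.1.1,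
      ¬ (p (c.route e.1.1 k) < x ↔ p (c.route e.1.1 (k + 1)) < x) := by
    rintro ⟨⟨w, b⟩, he⟩
    by_contra! hall
    have hind : ∀ k ≤ c.len w, (p (c.route w 0) < x ↔ p (c.route w k) < x) := fun k => by
      induction k with
      | zero => exact fun _ => Iff.rfl
      | succ k ih => exact fun hk => (ih (by omega)).trans (hall k hk)
    have hends := hind _ le_rfl
    rw [c.route_zero, c.route_len] at hends
    rcases hY with rfl | rfl <;> rcases b <;> simp [Incoming] at he <;> omega
  choose k hk hkx using hcross
  have hside : ∀ e, q (c.route e.1.1 (k e)) = q (c.route e.1.1 (k e + 1)) ∧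
      ((p (c.route e.1.1 (k e)) = x - 1 ∧ p (c.route e.1.1 (k e + 1)) = x) ∨
        (p (c.route e.1.1 (k e)) = x ∧ p (c.route e.1.1 (k e + 1)) = x - 1)) := fun e => by
    have h1 := hkx e
    rcases hadj _ _ (c.route_adjacent e.1.1 (k e) (hk e)) with h2 | ⟨h2, h3⟩
    · rw [h2] at h1
      exact absurd Iff.rfl h1
    · refine ⟨h3, ?_⟩
      rcases abs_eq (zero_le_one' ℤ) |>.1 h2 with h2 | h2 <;> omega
  let g (e : {e // c.Incoming Y e}) : Finset.Ico (0 : ℤ) h :=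
    ⟨q (c.route e.1.1 (k e)), hq _ (c.route_mem _ _ (hk e).le)⟩
  have hg : Function.Injective g := fun e e' hee => by
    have hqq : q (c.route e.1.1 (k e)) = q (c.route e'.1.1 (k e')) := congrArg Subtype.val hee
    have hw : e.1.1 = e'.1.1 := by
      obtain ⟨h1, h2⟩ := hside e
      obtain ⟨h1', h2'⟩ := hside e'
      refine (c.side_unique _ _ _ _ (hk e) (hk e') (Sym2.eq_iff.2 ?_)).1
      rcases h2 with ⟨h2, h3⟩ | ⟨h2, h3⟩ <;> rcases h2' with ⟨h2', h3'⟩ | ⟨h2', h3'⟩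
      · exact Or.inl ⟨hpq _ _ (by omega) (by omega), hpq _ _ (by omega) (by omega)⟩
      · exact Or.inr ⟨hpq _ _ (by omega) (by omega), hpq _ _ (by omega) (by omega)⟩
      · exact Or.inr ⟨hpq _ _ (by omega) (by omega), hpq _ _ (by omega) (by omega)⟩
      · exact Or.inl ⟨hpq _ _ (by omega) (by omega), hpq _ _ (by omega) (by omega)⟩
    obtain ⟨⟨w, b⟩, he⟩ := e
    obtain ⟨⟨w', b'⟩, he'⟩ := e'
    obtain rfl : w = w' := hw
    by_cases hb : b' = b
    · subst hb
      rfl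
    -- A wire across the cut is incoming at only one of its ends.
    · obtain rfl : b' = !b := Bool.eq_not.2 hb
      exact absurd he'.1 he.2
  refine (Nat.card_le_card_of_injective g hg).trans_eq ?_
  rw [Nat.card_eq_fintype_card, Fintype.card_coe]
  simp

end ThompsonCircuit

/-! ### Circuits that compute polar encoding functions -/

theorem polarEncode_eq (n : ℕ) (free : Finset (Fin (2 ^ n)))
    (frozen : {i : Fin (2 ^ n) // i ∉ free} → ZMod 2) (u : {i : Fin (2 ^ n) // i ∈ free} → ZMod 2) :
    polarEncode n free frozen u =
      u ᵥ* (polarG n).submatrix Subtype.val id + polarEncode n free frozen 0 := by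
  simp [polarEncode]

namespace ThompsonCircuit

variable {n : ℕ} {free : Finset (Fin (2 ^ n))} {frozen : {i : Fin (2 ^ n) // i ∉ free} → ZMod 2}
  {c : ThompsonCircuit {i : Fin (2 ^ n) // i ∈ free} (Fin (2 ^ n))}

/-- With no cycles, an input can affect only the output at its own node. But a row of the zeta
matrix has a 1 both on the diagonal and in the bottom column, so only the bottom row could be free.
-/
theorem cycles_pos (hc : c.Computes (polarEncode n free frozen)) (hfree : 2 ≤ free.card) :
    1 ≤ c.cycles := by
  by_contra hT
  have hT0 : c.cycles = 0 := by omega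
  have key : ∀ (i : {i // i ∈ free}) j, polarG n i j = 1 → c.inputNode i = c.outputNode j := by
    intro i j hij
    by_contra hne
    have h1 := hc (Pi.single i 1) j
    have h0 := hc 0 j
    rw [hT0] at h0 h1
    have hmem : (c.run (Pi.single i 1) 0).mem (c.outputNode j) =
        (c.run 0 0).mem (c.outputNode j) := by
      refine congrArg (c.init _) (funext fun i' => Pi.single_eq_of_ne (fun h => hne ?_) 1)
      rw [← h, i'.2]
    rw [hmem, h0, polarEncode_eq n free frozen (Pi.single i 1)] at h1
    simp [hij] at h1
  have hrow : ∀ i ∈ free, rowDigits n i = fun _ => false := fun i hi => by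
    have h1 := key ⟨i, hi⟩ ((digits n).symm (rowDigits n i)) (by simp [polarG_apply, zeta_self])
    have h2 := key ⟨i, hi⟩ ((digits n).symm fun _ => false) (by simp [polarG_apply, zeta_bot])
    exact (digits n).symm.injective (c.outputNode_injective (h1.symm.trans h2))
  have hle : free.card ≤ 1 := Finset.card_le_one.2 fun i hi j hj =>
    (rowDigits n).injective ((hrow i hi).trans (hrow j hj).symm)
  omega

/-- The bisection bound in the direction of the coordinate `p`, where `q` is the coordinate along
the cuts. -/
theorem sq_card_le (hc : c.Computes (polarEncode n free frozen)) (hfree : 2 ≤ free.card)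
    {p q : Square → ℤ} {w h : ℕ}
    (hadj : ∀ s t, Square.Adjacent s t → p s = p t ∨ (|p s - p t| = 1 ∧ q s = q t))
    (hpq : ∀ s t, p s = p t → q s = q t → s = t) (hp : ∀ s ∈ c.chip, p s ∈ Finset.Ico (0 : ℤ) w)
    (hq : ∀ s ∈ c.chip, q s ∈ Finset.Ico (0 : ℤ) h) :
    free.card ^ 2 ≤ 8 * 2 ^ n * (h * c.cycles) := by
  classical
  let In : ℤ → Finset {i // i ∈ free} := fun x =>
    Finset.univ.filter fun i => p (c.pos (c.inputNode i)) < x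
  have hcardFree : (Finset.univ : Finset {i // i ∈ free}).card = free.card := by simp
  -- The median position `x`. One node may hold many inputs, so no straight cut need halve them;
  -- those at `x` are divided arbitrarily between `I` and `Iᶜ`.
  obtain ⟨x, hx, hx'⟩ : ∃ x : ℤ, (In x).card ≤ free.card / 2 ∧ free.card / 2 ≤ (In (x + 1)).card := by
    have hex : ∃ j : ℕ, free.card / 2 ≤ (In j).card := by
      refine ⟨w, ?_⟩
      have : In w = Finset.univ := Finset.filter_true_of_mem fun i _ =>
        (Finset.mem_Ico.1 (hp _ (c.pos_mem _))).2
      rw [this, hcardFree]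
      omega
    refine ⟨(Nat.find hex : ℤ) - 1, ?_, by simpa using Nat.find_spec hex⟩
    rcases hj : Nat.find hex with _ | j
    · have : In (((0 : ℕ) : ℤ) - 1) = ∅ := Finset.filter_false_of_mem fun i _ => by
        have := (Finset.mem_Ico.1 (hp _ (c.pos_mem (c.inputNode i)))).1
        push_cast
        omega
      rw [this]
      exact Nat.zero_le _
    · have := Nat.find_min hex (m := j) (by omega)
      push_cast
      rw [add_sub_cancel_right]
      omega
  obtain ⟨I, hI, hI', hIcard⟩ := Finset.exists_subsuperset_card_eq
    (show In x ⊆ In (x + 1) from fun i hi => by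
      simp only [In, Finset.mem_filter] at hi ⊢
      exact ⟨hi.1, by omega⟩) hx hx'
  let O : Finset (Fin (2 ^ n)) := Finset.univ.filter fun j => ¬ p (c.pos (c.outputNode j)) < x + 1
  let O' : Finset (Fin (2 ^ n)) := Finset.univ.filter fun j => p (c.pos (c.outputNode j)) < x
  have hOO' : Disjoint O O' := Finset.disjoint_left.2 fun j hj hj' => by
    simp only [O, O', Finset.mem_filter] at hj hj'
    omega
  have hmid : (O ∪ O')ᶜ.card ≤ h := by
    have hmem : ∀ j ∈ (O ∪ O')ᶜ, p (c.pos (c.outputNode j)) = x := fun j hj => by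
      simp [O, O'] at hj
      omega
    have := Finset.card_le_card_of_injOn (s := (O ∪ O')ᶜ) (t := Finset.Ico (0 : ℤ) h)
      (fun j => q (c.pos (c.outputNode j))) (fun j _ => hq _ (c.pos_mem _)) fun j hj j' hj' hjj =>
        c.outputNode_injective (c.pos_injective
          (hpq _ _ ((hmem j hj).trans (hmem j' hj').symm) hjj))
    simpa using this
  have hr := c.rank_le_of_incoming hc _ (polarEncode_eq n free frozen)
    {v | p (c.pos v) < x + 1}ᶜ I O
    (fun i hi => by simpa [In] using hI' hi) (fun j hj => by simpa [O] using hj)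
    (c.natCard_incoming_le hadj hpq hq (x + 1) _ (Or.inr rfl))
  have hr' := c.rank_le_of_incoming hc _ (polarEncode_eq n free frozen)
    {v | p (c.pos v) < x} Iᶜ O'
    (fun i hi hv => Finset.mem_compl.1 hi (hI (by simpa [In] using hv)))
    (fun j hj => by simpa [O'] using hj)
    (c.natCard_incoming_le hadj hpq hq x _ (Or.inl rfl))
  have hmap : ∀ (I : Finset {i // i ∈ free}) (O : Finset (Fin (2 ^ n))),
      ((polarG n).submatrix (Subtype.val : I.map (Function.Embedding.subtype _) → _)
        (Subtype.val : O → _)).rank ≤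
      (((polarG n).submatrix (Subtype.val : {i // i ∈ free} → _) id).submatrix
        (Subtype.val : I → _) (Subtype.val : O → _)).rank := fun I O => by
    have hpre : ∀ k : I.map (Function.Embedding.subtype _), ∃ i : I, i.1.1 = k.1 := fun k => by
      obtain ⟨i, hi, hik⟩ := Finset.mem_map.1 k.2
      exact ⟨⟨i, hi⟩, hik⟩
    choose r hr using hpre
    refine le_of_eq_of_le (congrArg Matrix.rank ?_) (rank_submatrix_le _ r id)
    ext k j
    simp [hr]
  have hmain := card_mul_card_le_of_rank (I.map (Function.Embedding.subtype _))
    (Iᶜ.map (Function.Embedding.subtype _)) O O' hOO'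
  rw [Finset.card_map, Finset.card_map, Finset.card_compl, Fintype.card_coe, hIcard] at hmain
  have hbound := hmain.trans (Nat.mul_le_mul_left _ (add_le_add
    (add_le_add ((hmap I O).trans hr) ((hmap Iᶜ O').trans hr')) hmid))
  -- The `+ 1` pays for odd `free.card`.
  have hsq : free.card ^ 2 ≤ 4 * (free.card / 2 * (free.card - free.card / 2)) + 1 := by
    obtain ⟨m, hm | hm⟩ := free.card.even_or_odd'
    · rw [hm, show 2 * m / 2 = m by omega, show 2 * m - m = m by omega]
      nlinarith
    · rw [hm, show (2 * m + 1) / 2 = m by omega, show 2 * m + 1 - m = m + 1 by omega]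
      nlinarith
  obtain ⟨T, hT⟩ := Nat.exists_eq_add_of_le' (cycles_pos hc hfree)
  rw [hT, Nat.add_sub_cancel] at hbound
  rw [hT]
  -- `hbound` now gives `4 * 2 ^ n * h * (2 * T + 1)` for `T + 1` cycles, which is `4 * 2 ^ n * h`
  -- below the goal; for `h > 0` this slack absorbs the parity term.
  rcases h with _ | h
  · simp at hbound
    omega
  · have : 1 ≤ 2 ^ n := Nat.one_le_two_pow
    nlinarith [Nat.zero_le (2 ^ n * h)]

end ThompsonCircuit

/-! ### Area, time and energy bounds -/

namespace PolarEncoder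

theorem N_mul_le {e : PolarEncoder} (hR : 1 / 2 < e.R) :
    (e.N : ℝ) * (2 * e.R - 1) / 8 ≤ e.circuit.height * e.T ∧
      (e.N : ℝ) * (2 * e.R - 1) / 8 ≤ e.circuit.width * e.T := by
  have hN : (0 : ℝ) < e.N := by simp [N]
  have hN2 : (2 : ℝ) ≤ e.N := by
    have : 2 ^ 1 ≤ 2 ^ e.n := Nat.pow_le_pow_right two_pos e.one_le_n
    simpa [N] using (Nat.cast_le (α := ℝ)).2 this
  have hRN : e.R * e.N = e.free.card := div_mul_cancel₀ _ hN.ne'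
  have hfree : 2 ≤ e.free.card := by
    have : (1 : ℝ) < e.free.card := by nlinarith
    exact_mod_cast this
  have hadj : ∀ s t : Square, s.Adjacent t →
      (s.1 = t.1 ∨ |s.1 - t.1| = 1 ∧ s.2 = t.2) ∧ (s.2 = t.2 ∨ |s.2 - t.2| = 1 ∧ s.1 = t.1) :=
    fun s t hst => by
      rcases hst with ⟨h1, h2⟩ | ⟨h1, h2⟩
      · exact ⟨Or.inl h1, Or.inr ⟨h2, h1⟩⟩
      · exact ⟨Or.inr ⟨h1, h2⟩, Or.inl h2⟩
  have real_bound : ∀ h : ℕ, e.free.card ^ 2 ≤ 8 * 2 ^ e.n * (h * e.circuit.cycles) →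
      (e.N : ℝ) * (2 * e.R - 1) / 8 ≤ h * e.T := fun h hle => by
    have hle' : (e.free.card : ℝ) ^ 2 ≤ 8 * e.N * (h * e.T) := by
      simpa [N, T] using (Nat.cast_le (α := ℝ)).2 hle
    rw [← hRN] at hle'
    -- The cut bound has `R ^ 2`; it is weakened by `2 * R - 1 ≤ R ^ 2`.
    have h1 : (e.N : ℝ) * (e.N * (2 * e.R - 1)) ≤ e.N * (8 * (h * e.T)) := by
      nlinarith [sq_nonneg ((e.N : ℝ) * (e.R - 1))]
    linarith [le_of_mul_le_mul_left h1 hN]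
  exact ⟨real_bound _ (ThompsonCircuit.sq_card_le e.computes hfree (fun s t hst => (hadj s t hst).1)
      (fun s t => Prod.ext) (fun s hs => (Finset.mem_product.1 hs).1)
      fun s hs => (Finset.mem_product.1 hs).2),
    real_bound _ (ThompsonCircuit.sq_card_le e.computes hfree (fun s t hst => (hadj s t hst).2)
      (fun s t h2 h1 => Prod.ext h1 h2) (fun s hs => (Finset.mem_product.1 hs).2)
      fun s hs => (Finset.mem_product.1 hs).1)⟩

theorem N_le_A (e : PolarEncoder) : e.N ≤ e.A := by
  have h := Finset.card_le_card_of_injOn (s := Finset.univ) (t := e.circuit.chip)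
    (fun j => e.circuit.pos (e.circuit.outputNode j)) (fun j _ => e.circuit.pos_mem _)
    (e.circuit.pos_injective.comp e.circuit.outputNode_injective).injOn
  simpa [ThompsonCircuit.chip, N, A, ThompsonCircuit.area] using h

theorem area_mul_sq_cycles_ge {e : PolarEncoder} (hR : 1 / 2 < e.R) :
    (e.N : ℝ) ^ 2 * (1 - 2 * e.R) ^ 2 / 64 ≤ (e.A : ℝ) * (e.T : ℝ) ^ 2 := by
  obtain ⟨h1, h2⟩ := N_mul_le hR
  have h0 : 0 ≤ (e.N : ℝ) * (2 * e.R - 1) / 8 :=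
    div_nonneg (mul_nonneg (Nat.cast_nonneg _) (by linarith)) (by norm_num)
  have hA : (e.A : ℝ) = e.circuit.width * e.circuit.height := by
    simp [A, ThompsonCircuit.area]
  rw [hA]
  linarith [mul_le_mul h2 h1 h0 (h0.trans h2)]

theorem area_mul_cycles_ge {e : PolarEncoder} (hR : 1 / 2 < e.R) :
    (e.N : ℝ) ^ (3 / 2 : ℝ) * (2 * e.R - 1) / 8 ≤ (e.A : ℝ) * e.T := by
  have hN : (0 : ℝ) < e.N := by simp [N]
  have hNA : (e.N : ℝ) ≤ e.A := Nat.cast_le.2 e.N_le_A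
  have hpow : ((e.N : ℝ) ^ (3 / 2 : ℝ)) ^ 2 = (e.N : ℝ) ^ 3 := by
    rw [← Real.rpow_natCast, ← Real.rpow_mul hN.le, ← Real.rpow_natCast]
    norm_num
  -- `(A * T) ^ 2 = A * (A * T ^ 2)`, where the first factor is at least `N`.
  refine le_of_sq_le_sq ?_ (by positivity)
  calc ((e.N : ℝ) ^ (3 / 2 : ℝ) * (2 * e.R - 1) / 8) ^ 2
      = e.N * ((e.N : ℝ) ^ 2 * (1 - 2 * e.R) ^ 2 / 64) := by
        rw [div_pow, mul_pow, hpow]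
        ring
    _ ≤ e.A * ((e.A : ℝ) * (e.T : ℝ) ^ 2) :=
        mul_le_mul hNA (area_mul_sq_cycles_ge hR) (by positivity) (by positivity)
    _ = ((e.A : ℝ) * e.T) ^ 2 := by ring

theorem q_nonneg (e : PolarEncoder) : 0 ≤ e.q :=
  div_nonneg (Finset.sum_nonneg fun _ _ => div_nonneg
    (Finset.sum_nonneg fun _ _ => e.activity.level_nonneg _ _) (Nat.cast_nonneg _))
    (Nat.cast_nonneg _)

theorem energy_eq (e : PolarEncoder) : e.energy = e.q * ((e.A : ℝ) * e.T) :=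
  mul_assoc _ _ _

theorem energy_ge {e : PolarEncoder} (hR : 1 / 2 < e.R) :
    e.q * ((e.N : ℝ) ^ (3 / 2 : ℝ) * (2 * e.R - 1) / 8) ≤ e.energy := by
  rw [energy_eq]
  exact mul_le_mul_of_nonneg_left (area_mul_cycles_ge hR) e.q_nonneg

end PolarEncoder

theorem mainTheorem1 :
    (∀ e : PolarEncoder, 1 / 2 < e.R →
      (e.N : ℝ) ^ 2 * (1 - 2 * e.R) ^ 2 / 64 ≤ (e.A : ℝ) * (e.T : ℝ) ^ 2 ∧
      e.q * ((e.N : ℝ) ^ (3 / 2 : ℝ) * (2 * e.R - 1) / 8) ≤ e.energy) ∧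
    (∀ (R₀ : ℝ), 1 / 2 < R₀ → ∀ (e : ℕ → PolarEncoder), (∀ k, R₀ ≤ (e k).R) →
      Tendsto (fun k => (e k).N) atTop atTop →
      ((fun k => ((e k).N : ℝ) ^ 2) =O[atTop] fun k => ((e k).A : ℝ) * ((e k).T : ℝ) ^ 2) ∧
      ∀ q₀ : ℝ, 0 < q₀ → (∀ k, q₀ ≤ (e k).q) →
        ((fun k => ((e k).N : ℝ) ^ (3 / 2 : ℝ)) =O[atTop] fun k => (e k).energy)) := by
  refine ⟨fun e hR => ⟨e.area_mul_sq_cycles_ge hR, e.energy_ge hR⟩, fun R₀ hR₀ e he _ => ⟨?_, ?_⟩⟩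
  · have hpos : 0 < (2 * R₀ - 1) ^ 2 / 64 := div_pos (pow_pos (by linarith) 2) (by norm_num)
    refine IsBigO.of_bound ((2 * R₀ - 1) ^ 2 / 64)⁻¹ (Eventually.of_forall fun k => ?_)
    rw [Real.norm_of_nonneg (by positivity), Real.norm_of_nonneg (by positivity),
      le_inv_mul_iff₀ hpos]
    have hR : (2 * R₀ - 1) ^ 2 ≤ (1 - 2 * (e k).R) ^ 2 := by nlinarith [he k]
    calc (2 * R₀ - 1) ^ 2 / 64 * ((e k).N : ℝ) ^ 2
        ≤ (1 - 2 * (e k).R) ^ 2 / 64 * ((e k).N : ℝ) ^ 2 := by gcongr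
      _ = ((e k).N : ℝ) ^ 2 * (1 - 2 * (e k).R) ^ 2 / 64 := by ring
      _ ≤ _ := (e k).area_mul_sq_cycles_ge (hR₀.trans_le (he k))
  · intro q₀ hq₀ hq
    have hpos : 0 < q₀ * ((2 * R₀ - 1) / 8) := mul_pos hq₀ (by linarith)
    refine IsBigO.of_bound (q₀ * ((2 * R₀ - 1) / 8))⁻¹ (Eventually.of_forall fun k => ?_)
    have henergy := (e k).energy_ge (hR₀.trans_le (he k))
    have hle : q₀ * ((2 * R₀ - 1) / 8) * ((e k).N : ℝ) ^ (3 / 2 : ℝ) ≤ (e k).energy := by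
      refine le_trans ?_ henergy
      calc q₀ * ((2 * R₀ - 1) / 8) * ((e k).N : ℝ) ^ (3 / 2 : ℝ)
          = q₀ * (((e k).N : ℝ) ^ (3 / 2 : ℝ) * (2 * R₀ - 1) / 8) := by ring
        _ ≤ (e k).q * (((e k).N : ℝ) ^ (3 / 2 : ℝ) * (2 * (e k).R - 1) / 8) := by
            refine mul_le_mul (hq k) ?_ ?_ (e k).q_nonneg
            · have := he k
              gcongr
            · exact div_nonneg (mul_nonneg (by positivity) (by linarith)) (by norm_num)
    rw [Real.norm_of_nonneg (by positivity),
      Real.norm_of_nonneg ((mul_nonneg hpos.le (by positivity)).trans hle), le_inv_mul_iff₀ hpos]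
    exact hle
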